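/- Consider lattice paths in $\mathbb Z^2$ with steps $N=(0,1)$ and $E=(1,0)$. Number the vertices of a path $P$ consecutively from $0$ at its starting point; a valley of $P$ is a vertex preceded by an $E$ step and followed by an $N$ step, and $\operatorname{maj}(P)$ is the sum of the positions of the valleys of $P$. For points $A=(x,y)$ and $B=(u,v)$ of $\mathbb Z^2$ write $A\prec B$ if $x<u$ and $y>v$. For integers $n,m$ let $$\binom{n}{m}_q=\frac{(1-q^n)(1-q^{n-1})\cdots(1-q^{n-m+1})}{(1-q^m)(1-q^{m-1})\cdots(1-q)}\quad\text{if }0\le m\le n,$$ and $\binom{n}{m}_q=0$ otherwise, where $q$ is an indeterminate. Let $I_i=(x_i,y_i)$ and $F_i=(u_i,v_i)$, $1\le i\le k$, be points in $\mathbb Z^2$ with $I_1\prec I_2\prec\dots\prec I_k$ and $F_1\prec F_2\prec\dots\prec F_k$, and suppose that $x_i+y_i$ is the same for all $i$. Let $\mathfrak P^\circ$ be the set of tuples $\mathbf P=(P_1,\dots,P_k)$, where $P_i$ is a path from $I_i$ to $F_i$ for each $i$, such that no point of $\mathbb Z^2$ lies on more than one of the paths $P_1,\dots,P_k$, and let $\operatorname{maj}(\mathbf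 P)=\sum_{i=1}^k\operatorname{maj}(P_i)$. Then $$\sum_{\mathbf P\in\mathfrak P^\circ}q^{\operatorname{maj}(\mathbf P)}=\det_{1\le i,j\le k}\left(q^{i(x_i-x_j)}\binom{u_i-x_j+v_i-y_j}{u_i-x_j}_q\right).$$ -/

import Mathlib

open scoped BigOperators

/-- The two kinds of unit steps of a lattice path: north `(0,1)` and east `(1,0)`. -/
inductive NEStep where
  | N : NEStep
  | E : NEStep
  deriving DecidableEq

instance : Fintype NEStep where
  elems := {NEStep.N, NEStep.E}
  complete := by
    intro s
    cases s <;> simp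

/-- The displacement vector of a step. -/
def NEStep.vec : NEStep → ℤ × ℤ
  | NEStep.N => (0, 1)
  | NEStep.E => (1, 0)

/-- A lattice path in `ℤ²` with `N` and `E` steps that starts at `A` and ends at `B`. -/
structure NEPath (A B : ℤ × ℤ) where
  /-- the successive steps of the path -/
  steps : List NEStep
  /-- starting from `A`, the steps lead to `B` -/
  ends_at : A + (steps.map NEStep.vec).sum = B

namespace NEPath

variable {A B : ℤ × ℤ}

/-- The vertex in position `t` of the path; the starting point `A` is in position `0`. -/
def vertex (P : NEPath A B) (t : ℕ) : ℤ × ℤ :=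
  A + ((P.steps.take t).map NEStep.vec).sum

/-- The set of all vertices of the path, that is, of all points of `ℤ²` lying on it. -/
def vertices (P : NEPath A B) : Set (ℤ × ℤ) :=
  {p | ∃ t : ℕ, t ≤ P.steps.length ∧ P.vertex t = p}

/-- The vertex in position `t` is a valley if it is preceded by an `E` and followed by an `N`. -/
def IsValley (P : NEPath A B) (t : ℕ) : Prop :=
  0 < t ∧ P.steps[t - 1]? = some NEStep.E ∧ P.steps[t]? = some NEStep.N

instance (P : NEPath A B) : DecidablePred P.IsValley := fun t => by
  unfold IsValley; infer_instance

/-- The major index of a path: the sum of the positions of its valleys. -/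
def maj (P : NEPath A B) : ℕ :=
  ∑ t ∈ (Finset.range P.steps.length).filter (fun t => P.IsValley t), t

theorem steps_injective : Function.Injective (NEPath.steps : NEPath A B → List NEStep) := by
  rintro ⟨s, hs⟩ ⟨t, ht⟩ h
  cases h
  rfl

theorem length_eq_aux (l : List NEStep) :
    ((l.map NEStep.vec).sum).1 + ((l.map NEStep.vec).sum).2 = (l.length : ℤ) := by
  induction l with
  | nil => simp
  | cons a l ih =>
    cases a <;> simp [NEStep.vec] <;> linarith

instance finite : Finite (NEPath A B) := by
  have hfin : {l : List NEStep | l.length = (B.1 - A.1 + (B.2 - A.2)).toNat}.Finite :=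
    List.finite_length_eq NEStep _
  have : Finite {l : List NEStep | l.length = (B.1 - A.1 + (B.2 - A.2)).toNat} := hfin
  refine Finite.of_injective
    (fun P : NEPath A B =>
      (⟨P.steps, ?_⟩ : {l : List NEStep | l.length = (B.1 - A.1 + (B.2 - A.2)).toNat})) ?_
  · have h := length_eq_aux P.steps
    have h1 := congrArg Prod.fst P.ends_at
    have h2 := congrArg Prod.snd P.ends_at
    simp only [Prod.fst_add, Prod.snd_add] at h1 h2
    show P.steps.length = _
    omega
  · intro P Q h
    exact steps_injective (congrArg Subtype.val h)

noncomputable instance : Fintype (NEPath A B) := Fintype.ofFinite _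

end NEPath

/-- `A ≺ B`: the point `A` is strictly northwest of the point `B`. -/
def StrictlyNW (A B : ℤ × ℤ) : Prop := A.1 < B.1 ∧ B.2 < A.2

/-- A tuple of paths is non-intersecting if no point of `ℤ²` is shared by two of its paths. -/
def NonIntersecting {k : ℕ} {S T : Fin k → ℤ × ℤ} (P : (i : Fin k) → NEPath (S i) (T i)) : Prop :=
  ∀ i j : Fin k, i ≠ j → ∀ p : ℤ × ℤ, ¬ (p ∈ (P i).vertices ∧ p ∈ (P j).vertices)

/-- The total major index of a tuple of paths. -/
def totalMaj {k : ℕ} {S T : Fin k → ℤ × ℤ} (P : (i : Fin k) → NEPath (S i) (T i)) : ℕ :=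
  ∑ i, (P i).maj

/-- The `q`-binomial coefficient `[n choose m]_q`, a rational function of the indeterminate
`q = RatFunc.X`: the quotient of `(1-q^n)(1-q^(n-1))⋯(1-q^(n-m+1))` by `(1-q^m)(1-q^(m-1))⋯(1-q)`
if `0 ≤ m ≤ n`, and `0` otherwise. -/
noncomputable def qBinom (n m : ℤ) : RatFunc ℚ :=
  if 0 ≤ m ∧ m ≤ n then
    (∏ l ∈ Finset.range m.toNat, (1 - (RatFunc.X : RatFunc ℚ) ^ (n - (l : ℤ)))) /
      (∏ l ∈ Finset.range m.toNat, (1 - (RatFunc.X : RatFunc ℚ) ^ (m - (l : ℤ))))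
  else 0

/-! With the starting points fixed on one antidiagonal, both sides are functions of the end points
`F` that obey the same recursions (`genFun_eq_detFun`). Tail swapping at a common point can create
or destroy a valley there, so no sign-reversing involution is used.

For a path of length `ℓ`, removing the last step leaves maj unchanged unless the path ends in `EN`,
where the valley contributes `q^(ℓ-1)`. Hence `g(p) = g(p-E) + g(p-N) + (q^(ℓ-1) - 1) g(p-E-N)`. The
q-binomials satisfy the same identity (`qBinom_three_term`), with coefficients independent of the
column because the starting points share an antidiagonal; so the determinant satisfies it in each
row.

For tuples, the recursion is applied to the last among the longest paths, say the `i`-th: the other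
paths then cannot reach `F i`. It fails only if `F (i+1) = F i - (0,1)`. In that case path `i` must
end in `E`, and the determinant agrees because, by q-Pascal, the `N` term of row `i` is a multiple
of row `i+1`. This is what the factors `q^(i(x_i-x_j))` are for. -/

/-! ### Recurrences for q-binomial coefficients -/

theorem one_sub_X_zpow_ne_zero {m : ℤ} (hm : 0 < m) : 1 - (RatFunc.X : RatFunc ℚ) ^ m ≠ 0 := by
  obtain ⟨n, rfl⟩ := Int.eq_ofNat_of_zero_le hm.le
  intro h
  rw [sub_eq_zero, zpow_natCast] at h
  have h2 : (1 : Polynomial ℚ) = Polynomial.X ^ n := by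
    apply IsFractionRing.injective (Polynomial ℚ) (RatFunc ℚ)
    simpa using h
  have h3 := congrArg Polynomial.natDegree h2
  simp at h3
  omega

theorem qBinom_eq_zero {n m : ℤ} (h : ¬ (0 ≤ m ∧ m ≤ n)) : qBinom n m = 0 := if_neg h

theorem qBinom_zero_zero : qBinom 0 0 = 1 := by simp [qBinom]

theorem one_sub_mul_qBinom (n m : ℤ) :
    (1 - (RatFunc.X : RatFunc ℚ) ^ m) * qBinom n m =
      (1 - (RatFunc.X : RatFunc ℚ) ^ n) * qBinom (n - 1) (m - 1) := by
  by_cases h : 0 < m ∧ m ≤ n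
  · obtain ⟨l, rfl⟩ : ∃ l : ℕ, m = l + 1 := ⟨(m - 1).toNat, by omega⟩
    have hm : (1 - (RatFunc.X : RatFunc ℚ) ^ ((l : ℤ) + 1)) ≠ 0 := one_sub_X_zpow_ne_zero h.1
    rw [qBinom, qBinom, if_pos (by omega), if_pos (by omega)]
    have e1 : ((l : ℤ) + 1).toNat = l + 1 := by omega
    have e2 : ((l : ℤ) + 1 - 1).toNat = l := by omega
    rw [e1, e2, Finset.prod_range_succ', Finset.prod_range_succ']
    have e3 : ∀ a : ℤ, ∏ t ∈ Finset.range l, (1 - (RatFunc.X : RatFunc ℚ) ^ (a - ((t + 1 : ℕ) : ℤ))) =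
        ∏ t ∈ Finset.range l, (1 - (RatFunc.X : RatFunc ℚ) ^ (a - 1 - (t : ℤ))) := by
      intro a
      refine Finset.prod_congr rfl fun t _ => ?_
      congr 2
      push_cast
      ring
    rw [e3, e3]
    simp only [Nat.cast_zero, sub_zero]
    field_simp
  · rw [qBinom_eq_zero (n := n - 1) (by omega), mul_zero]
    by_cases hm : m = 0
    · simp [hm]
    · rw [qBinom_eq_zero (by omega), mul_zero]

theorem one_sub_mul_qBinom_add_one (n m : ℤ) :
    (1 - (RatFunc.X : RatFunc ℚ) ^ (n + 1 - m)) * qBinom (n + 1) m =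
      (1 - (RatFunc.X : RatFunc ℚ) ^ (n + 1)) * qBinom n m := by
  by_cases h : 0 ≤ m ∧ m ≤ n
  · obtain ⟨l, rfl⟩ : ∃ l : ℕ, m = l := ⟨m.toNat, by omega⟩
    rw [qBinom, qBinom, if_pos (by omega), if_pos (by omega), ← mul_div_assoc, ← mul_div_assoc]
    congr 1
    rw [Int.toNat_natCast, mul_comm, ← Finset.prod_range_succ
      (fun t : ℕ => 1 - (RatFunc.X : RatFunc ℚ) ^ (n + 1 - (t : ℤ))), Finset.prod_range_succ',
      mul_comm]
    congr 1
    · simp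
    · refine Finset.prod_congr rfl fun t _ => ?_
      congr 2
      push_cast
      ring
  · rw [qBinom_eq_zero h, mul_zero]
    -- At `m = n + 1` the q-binomial is nonzero for `n ≥ -1`, but its factor `1 - q^0` vanishes.
    by_cases hm : m = n + 1
    · simp [hm]
    · rw [qBinom_eq_zero (by omega), mul_zero]

/-- The two absorption identities combine after multiplication by `1 - q^(n+1)`. The case `n = -1`,
`m = 0` would fail. -/
theorem qBinom_pascal (n m : ℤ) (hn : 0 ≤ n) :
    qBinom (n + 1) m = qBinom n (m - 1) + (RatFunc.X : RatFunc ℚ) ^ m * qBinom n m := by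
  have hX : (RatFunc.X : RatFunc ℚ) ≠ 0 := RatFunc.X_ne_zero
  have h0 := one_sub_X_zpow_ne_zero (show 0 < n + 1 by omega)
  have h1 := one_sub_mul_qBinom (n + 1) m
  have h2 := one_sub_mul_qBinom_add_one n m
  have h3 : (RatFunc.X : RatFunc ℚ) ^ m * (RatFunc.X : RatFunc ℚ) ^ (n + 1 - m) =
      (RatFunc.X : RatFunc ℚ) ^ (n + 1) := by
    rw [← zpow_add₀ hX]
    congr 1
    ring
  rw [add_sub_cancel_right] at h1
  apply mul_left_cancel₀ h0
  linear_combination h1 + (RatFunc.X : RatFunc ℚ) ^ m * h2 + qBinom (n + 1) m * h3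

theorem qBinom_three_term (n m : ℤ) (hn : 0 ≤ n) :
    qBinom (n + 1) m = qBinom n (m - 1) + qBinom n m +
      ((RatFunc.X : RatFunc ℚ) ^ n - 1) * qBinom (n - 1) (m - 1) := by
  linear_combination qBinom_pascal n m hn - one_sub_mul_qBinom n m

/-! ### Step lists, whose type does not depend on the end points -/

namespace LatticePath

/-- The total displacement of a list of steps. -/
def disp (l : List NEStep) : ℤ × ℤ := (l.map NEStep.vec).sum

/-- The points visited by the steps `l` when starting at `A`. -/
def points (A : ℤ × ℤ) (l : List NEStep) : Set (ℤ × ℤ) := {p | ∃ l', l' <+: l ∧ A + disp l' = p}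

/-- The major index of a list of steps. -/
def majSteps (l : List NEStep) : ℕ :=
  ∑ t ∈ Finset.range l.length,
    if 0 < t ∧ l[t - 1]? = some NEStep.E ∧ l[t]? = some NEStep.N then t else 0

@[simp] theorem disp_nil : disp [] = 0 := rfl

theorem disp_append (l l' : List NEStep) : disp (l ++ l') = disp l + disp l' := by
  simp [disp]

theorem disp_singleton (s : NEStep) : disp [s] = s.vec := by simp [disp]

theorem vec_nonneg (s : NEStep) : 0 ≤ s.vec := by
  cases s <;> simp [NEStep.vec, Prod.le_def]

theorem disp_nonneg (l : List NEStep) : 0 ≤ disp l :=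
  List.sum_nonneg (by simp only [List.mem_map]; rintro _ ⟨s, -, rfl⟩; exact vec_nonneg s)

theorem le_of_mem_points {A p : ℤ × ℤ} {l : List NEStep} (h : p ∈ points A l) :
    p ≤ A + disp l := by
  obtain ⟨l', ⟨r, rfl⟩, rfl⟩ := h
  rw [disp_append, ← add_assoc]
  exact le_add_of_nonneg_right (disp_nonneg r)

theorem end_mem_points (A : ℤ × ℤ) (l : List NEStep) : A + disp l ∈ points A l :=
  ⟨l, List.prefix_rfl, rfl⟩

theorem points_concat (A : ℤ × ℤ) (l : List NEStep) (s : NEStep) :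
    points A (l ++ [s]) = insert (A + disp l + s.vec) (points A l) := by
  ext p
  simp only [points, Set.mem_ofPred_eq, Set.mem_insert_iff, List.prefix_concat_iff]
  constructor
  · rintro ⟨l', rfl | h, rfl⟩
    · left; rw [disp_append, disp_singleton, add_assoc]
    · exact Or.inr ⟨l', h, rfl⟩
  · rintro (rfl | ⟨l', h, rfl⟩)
    · exact ⟨l ++ [s], Or.inl rfl, by rw [disp_append, disp_singleton, add_assoc]⟩
    · exact ⟨l', Or.inr h, rfl⟩

theorem majSteps_concat (l : List NEStep) (s : NEStep) :
    majSteps (l ++ [s]) =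
      majSteps l + if l.getLast? = some NEStep.E ∧ s = NEStep.N then l.length else 0 := by
  rw [majSteps, List.length_append, List.length_singleton, Finset.sum_range_succ, majSteps]
  congr 1
  · refine Finset.sum_congr rfl fun t ht => ?_
    rw [Finset.mem_range] at ht
    rw [List.getElem?_append_left ht, List.getElem?_append_left (by omega)]
  · rw [List.getElem?_concat_length, List.getLast?_eq_getElem?]
    rcases Nat.eq_zero_or_pos l.length with h | h
    · simp [h]
    · rw [List.getElem?_append_left (by omega)]
      simp [h]

theorem vertices_eq_points {A B : ℤ × ℤ} (P : NEPath A B) : P.vertices = points A P.steps := by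
  ext p
  constructor
  · rintro ⟨t, -, rfl⟩
    exact ⟨P.steps.take t, List.take_prefix _ _, rfl⟩
  · rintro ⟨l', h, rfl⟩
    refine ⟨l'.length, h.length_le, ?_⟩
    rw [NEPath.vertex, ← List.prefix_iff_eq_take.1 h]
    rfl

theorem maj_eq_majSteps {A B : ℤ × ℤ} (P : NEPath A B) : P.maj = majSteps P.steps := by
  rw [NEPath.maj, Finset.sum_filter]
  rfl

variable {k : ℕ}

/-- The non-intersecting tuples of paths from `I i` to `F i`, given by their lists of steps. -/
def tuples (I F : Fin k → ℤ × ℤ) : Set (Fin k → List NEStep) :=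
  {L | (∀ i, I i + disp (L i) = F i) ∧
    ∀ i j, i ≠ j → Disjoint (points (I i) (L i)) (points (I j) (L j))}

/-- The weight of a tuple of paths. -/
noncomputable def weight (L : Fin k → List NEStep) : RatFunc ℚ :=
  RatFunc.X ^ ∑ i, majSteps (L i)

/-- The generating function of non-intersecting tuples of paths by major index. -/
noncomputable def genFun (I F : Fin k → ℤ × ℤ) : RatFunc ℚ := ∑ᶠ L ∈ tuples I F, weight L

theorem tuples_eq_image (I F : Fin k → ℤ × ℤ) :
    tuples I F = (fun (P : ∀ i, NEPath (I i) (F i)) i => (P i).steps) '' {P | NonIntersecting P} := by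
  ext L
  constructor
  · rintro ⟨h1, h2⟩
    refine ⟨fun i => ⟨L i, h1 i⟩, ?_, rfl⟩
    intro i j hij p hp
    rw [vertices_eq_points, vertices_eq_points] at hp
    exact Set.disjoint_left.1 (h2 i j hij) hp.1 hp.2
  · rintro ⟨P, hP, rfl⟩
    refine ⟨fun i => (P i).ends_at, fun i j hij => Set.disjoint_left.2 fun p hi hj => ?_⟩
    exact hP i j hij p ⟨by rwa [vertices_eq_points], by rwa [vertices_eq_points]⟩

theorem tuples_finite (I F : Fin k → ℤ × ℤ) : (tuples I F).Finite := by
  rw [tuples_eq_image]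
  exact Set.toFinite _

open Classical in
theorem sum_eq_genFun (I F : Fin k → ℤ × ℤ) :
    (∑ P : ((i : Fin k) → NEPath (I i) (F i)) with NonIntersecting P,
        (RatFunc.X : RatFunc ℚ) ^ totalMaj P) = genFun I F := by
  rw [genFun, tuples_eq_image, finsum_mem_image, ← finsum_mem_coe_finset]
  · simp only [Finset.coe_filter, Finset.mem_univ, true_and, weight, totalMaj, maj_eq_majSteps]
  · intro P _ Q _ h
    funext i
    exact NEPath.steps_injective (congrFun h i)

/-! ### Recursions for the generating function -/

/-- Append a step to one of the paths of a tuple. -/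
def appendStep (i : Fin k) (s : NEStep) (L : Fin k → List NEStep) : Fin k → List NEStep :=
  Function.update L i (L i ++ [s])

theorem appendStep_injective (i : Fin k) (s : NEStep) : Function.Injective (appendStep i s) := by
  intro L L' h
  funext j
  have hj := congrFun h j
  by_cases hji : j = i
  · subst hji
    simpa [appendStep] using hj
  · simpa [appendStep, hji] using hj

theorem weight_appendStep (i : Fin k) (s : NEStep) (L : Fin k → List NEStep) :
    weight (appendStep i s L) = weight L *
      if (L i).getLast? = some NEStep.E ∧ s = NEStep.N then RatFunc.X ^ (L i).length else 1 := by
  have h : ∑ j, majSteps (appendStep i s L j) = ∑ j, majSteps (L j) +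
      if (L i).getLast? = some NEStep.E ∧ s = NEStep.N then (L i).length else 0 := by
    rw [← Finset.add_sum_erase _ _ (Finset.mem_univ i),
      ← Finset.add_sum_erase _ (fun j => majSteps (L j)) (Finset.mem_univ i)]
    have h1 : ∑ j ∈ Finset.univ.erase i, majSteps (appendStep i s L j) =
        ∑ j ∈ Finset.univ.erase i, majSteps (L j) := by
      refine Finset.sum_congr rfl fun j hj => ?_
      rw [appendStep, Function.update_of_ne (Finset.ne_of_mem_erase hj)]
    rw [h1, appendStep, Function.update_self, majSteps_concat]
    ring
  rw [weight, h, pow_add, weight]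
  congr 1
  split_ifs <;> simp

theorem weight_appendStep_E (i : Fin k) (L : Fin k → List NEStep) :
    weight (appendStep i NEStep.E L) = weight L := by
  simp [weight_appendStep]

theorem image_appendStep {I F : Fin k → ℤ × ℤ} {i : Fin k} (s : NEStep)
    (hlt : ∀ j < i, (F j).1 < (F i).1) (hgt : ∀ j, i < j → (F j).2 < (F i).2) :
    appendStep i s '' tuples I (Function.update F i (F i - s.vec)) =
      {L ∈ tuples I F | (L i).getLast? = some s} := by
  ext L
  constructor
  · rintro ⟨L, ⟨h1, h2⟩, rfl⟩
    have hi : I i + disp (L i) = F i - s.vec := by simpa using h1 i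
    have hne : ∀ j, j ≠ i → I j + disp (L j) = F j := fun j hj => by simpa [hj] using h1 j
    have hnew : ∀ j, j ≠ i → Disjoint (points (I i) (L i ++ [s])) (points (I j) (L j)) := by
      intro j hj
      rw [points_concat, Set.disjoint_insert_left]
      refine ⟨fun hm => ?_, h2 i j hj.symm⟩
      -- Every point of path `j` is weakly southwest of `F j`, whereas the new vertex `F i` is
      -- strictly east of `F j` if `j < i` and strictly north of it if `j > i`.
      have := le_of_mem_points hm
      rw [hi, hne j hj, sub_add_cancel, Prod.le_def] at this
      rcases lt_or_gt_of_ne hj with h | h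
      · exact absurd (hlt j h) (not_lt.2 this.1)
      · exact absurd (hgt j h) (not_lt.2 this.2)
    refine ⟨⟨fun j => ?_, fun j j' hjj => ?_⟩, by simp [appendStep]⟩
    · by_cases hj : j = i
      · subst hj
        simp [appendStep, disp_append, disp_singleton, ← add_assoc, hi]
      · simpa [appendStep, hj] using hne j hj
    · by_cases hj : j = i
      · subst hj
        simpa [appendStep, hjj.symm] using hnew j' hjj.symm
      · by_cases hj' : j' = i
        · subst hj'
          simpa [appendStep, hj] using (hnew j hj).symm
        · simpa [appendStep, hj, hj'] using h2 j j' hjj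
  · rintro ⟨⟨h1, h2⟩, h3⟩
    obtain ⟨l, hl⟩ := List.getLast?_eq_some_iff.1 h3
    have hsub : ∀ j, points (I j) (Function.update L i l j) ⊆ points (I j) (L j) := by
      intro j
      by_cases hj : j = i
      · subst hj
        rw [Function.update_self, hl, points_concat]
        exact Set.subset_insert _ _
      · rw [Function.update_of_ne hj]
    refine ⟨Function.update L i l, ⟨fun j => ?_, fun j j' hjj =>
      (h2 j j' hjj).mono (hsub j) (hsub j')⟩, ?_⟩
    · by_cases hj : j = i
      · subst hj
        rw [Function.update_self, Function.update_self, ← h1 j, hl, disp_append, disp_singleton]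
        abel
      · simpa [hj] using h1 j
    · simp [appendStep, ← hl]

theorem finsum_appendStep {I F : Fin k → ℤ × ℤ} {i : Fin k} (s : NEStep)
    (hlt : ∀ j < i, (F j).1 < (F i).1) (hgt : ∀ j, i < j → (F j).2 < (F i).2)
    (f : (Fin k → List NEStep) → RatFunc ℚ) :
    ∑ᶠ L ∈ {L ∈ tuples I F | (L i).getLast? = some s}, f L =
      ∑ᶠ L ∈ tuples I (Function.update F i (F i - s.vec)), f (appendStep i s L) := by
  rw [← image_appendStep s hlt hgt, finsum_mem_image (appendStep_injective i s).injOn]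

theorem length_of_mem_tuples {I F : Fin k → ℤ × ℤ} {L : Fin k → List NEStep}
    (h : L ∈ tuples I F) (i : Fin k) :
    ((L i).length : ℤ) = (F i).1 + (F i).2 - ((I i).1 + (I i).2) := by
  have h1 := NEPath.length_eq_aux (L i)
  have h2 := congrArg Prod.fst (h.1 i)
  have h3 := congrArg Prod.snd (h.1 i)
  simp only [Prod.fst_add, Prod.snd_add, disp] at h2 h3
  omega

theorem genFun_split_last {I F : Fin k → ℤ × ℤ} {i : Fin k}
    (hpos : (I i).1 + (I i).2 < (F i).1 + (F i).2)
    (hlt : ∀ j < i, (F j).1 < (F i).1) (hgt : ∀ j, i < j → (F j).2 < (F i).2) :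
    genFun I F = genFun I (Function.update F i (F i - (1, 0))) +
      ∑ᶠ L ∈ tuples I (Function.update F i (F i - (0, 1))), weight (appendStep i NEStep.N L) := by
  have hE := finsum_appendStep (I := I) NEStep.E hlt hgt weight
  have hN := finsum_appendStep (I := I) NEStep.N hlt hgt weight
  simp only [weight_appendStep_E] at hE
  have hU : tuples I F = {L ∈ tuples I F | (L i).getLast? = some NEStep.E} ∪
      {L ∈ tuples I F | (L i).getLast? = some NEStep.N} := by
    ext L
    simp only [Set.mem_union, Set.mem_ofPred_eq, ← and_or_left]
    refine ⟨fun h => ⟨h, ?_⟩, fun h => h.1⟩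
    have hlen := length_of_mem_tuples h i
    rcases List.eq_nil_or_concat (L i) with h0 | ⟨l, s, h0⟩
    · rw [h0] at hlen
      simp at hlen
      omega
    · cases s <;> simp [h0]
  rw [genFun, hU, finsum_mem_union, hE, hN]
  · rfl
  · rw [Set.disjoint_left]
    rintro L ⟨-, h1⟩ ⟨-, h2⟩
    simp [h1] at h2
  · exact (tuples_finite I F).subset (Set.sep_subset _ _)
  · exact (tuples_finite I F).subset (Set.sep_subset _ _)

theorem tuples_eq_empty_of_eq {I F : Fin k → ℤ × ℤ} {i j : Fin k} (hij : i ≠ j) (h : F i = F j) :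
    tuples I F = ∅ := by
  rw [Set.eq_empty_iff_forall_notMem]
  rintro L ⟨h1, h2⟩
  refine Set.disjoint_left.1 (h2 i j hij) (end_mem_points _ _) ?_
  rw [h1 i, h, ← h1 j]
  exact end_mem_points _ _

theorem genFun_of_end_below {I F : Fin k → ℤ × ℤ} {i j : Fin k} (hij : i ≠ j)
    (hpos : (I i).1 + (I i).2 < (F i).1 + (F i).2)
    (hlt : ∀ j < i, (F j).1 < (F i).1) (hgt : ∀ j, i < j → (F j).2 < (F i).2)
    (h : F j = F i - (0, 1)) :
    genFun I F = genFun I (Function.update F i (F i - (1, 0))) := by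
  rw [genFun_split_last hpos hlt hgt, tuples_eq_empty_of_eq hij (by simp [hij.symm, h]),
    finsum_mem_empty, add_zero]

/-- The gap of at least 2 below `F i` allows path `i` to be extended freely to `F i - (0,1)` as
well, so that the tuples ending in `EN` are exactly counted by the end point `F i - (1,1)`. -/
theorem genFun_three_term {I F : Fin k → ℤ × ℤ} {i : Fin k}
    (hpos : (I i).1 + (I i).2 < (F i).1 + (F i).2)
    (hlt : ∀ j < i, (F j).1 < (F i).1) (hgt : ∀ j, i < j → (F j).2 < (F i).2 - 1) :
    genFun I F = genFun I (Function.update F i (F i - (1, 0))) +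
      genFun I (Function.update F i (F i - (0, 1))) +
      ((RatFunc.X : RatFunc ℚ) ^ ((F i).1 + (F i).2 - ((I i).1 + (I i).2) - 1) - 1) *
        genFun I (Function.update F i (F i - (1, 1))) := by
  set c : RatFunc ℚ := RatFunc.X ^ ((F i).1 + (F i).2 - ((I i).1 + (I i).2) - 1) - 1
  set F' := Function.update F i (F i - (0, 1))
  have hne : ∀ j, j ≠ i → F' j = F j := fun j hj => Function.update_of_ne hj _ _
  have hi : F' i = F i - (0, 1) := Function.update_self _ _ _
  have key := finsum_appendStep (I := I) (F := F') (i := i) NEStep.E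
    (fun j hj => by simpa [hne j hj.ne, hi] using hlt j hj)
    (fun j hj => by simpa [hne j hj.ne', hi] using hgt j hj) (fun L => c * weight L)
  simp only [weight_appendStep_E] at key
  have hF : Function.update F' i (F' i - NEStep.E.vec) = Function.update F i (F i - (1, 1)) := by
    rw [hi, Function.update_idem]
    simp [NEStep.vec, sub_sub]
  rw [hF] at key
  rw [genFun_split_last hpos hlt fun j hj => (hgt j hj).trans (by omega), add_assoc]
  congr 1
  have h1 : ∀ L ∈ tuples I F', weight (appendStep i NEStep.N L) = weight L +
      if (L i).getLast? = some NEStep.E then c * weight L else 0 := by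
    intro L hL
    have hlen := length_of_mem_tuples hL i
    rw [hi] at hlen
    simp only [Prod.fst_sub, Prod.snd_sub] at hlen
    rw [weight_appendStep]
    -- The valley created by the final `N` sits at the length of the shortened path.
    have : (RatFunc.X : RatFunc ℚ) ^ (L i).length = c + 1 := by
      rw [← zpow_natCast, hlen, sub_add_cancel]
      congr 1
      ring
    by_cases h : (L i).getLast? = some NEStep.E
    · simp only [h, and_self, if_true, this]
      ring
    · simp [h]
  rw [finsum_mem_congr rfl h1, finsum_mem_add_distrib (tuples_finite I F')]
  congr 1
  rw [genFun, mul_finsum_mem, ← key]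
  refine finsum_congr fun L => ?_
  by_cases hL : L ∈ tuples I F' <;> by_cases h : (L i).getLast? = some NEStep.E <;> simp [hL, h]

/-! ### The same recursions for the determinant -/

/-- The `i`-th row of the determinant, as a function of the end point `p` of the `i`-th path. -/
noncomputable def detRow (I : Fin k → ℤ × ℤ) (i : Fin k) (p : ℤ × ℤ) : Fin k → RatFunc ℚ :=
  fun j => (RatFunc.X : RatFunc ℚ) ^ (((i : ℕ) + 1 : ℤ) * ((I i).1 - (I j).1)) *
    qBinom (p.1 - (I j).1 + p.2 - (I j).2) (p.1 - (I j).1)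

/-- The determinant, as a function of the end points. -/
noncomputable def detFun (I F : Fin k → ℤ × ℤ) : RatFunc ℚ :=
  Matrix.det (Matrix.of fun i => detRow I i (F i))

theorem detFun_update (I F : Fin k → ℤ × ℤ) (i : Fin k) (p : ℤ × ℤ) :
    detFun I (Function.update F i p) =
      ((Matrix.of fun i => detRow I i (F i)).updateRow i (detRow I i p)).det := by
  rw [detFun]
  congr 1
  ext a b
  by_cases h : a = i
  · subst h
    simp
  · simp [h]

theorem detFun_three_term {I F : Fin k → ℤ × ℤ} {i : Fin k}
    (hdiag : ∀ i j : Fin k, (I i).1 + (I i).2 = (I j).1 + (I j).2)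
    (hpos : (I i).1 + (I i).2 < (F i).1 + (F i).2) :
    detFun I F = detFun I (Function.update F i (F i - (1, 0))) +
      detFun I (Function.update F i (F i - (0, 1))) +
      ((RatFunc.X : RatFunc ℚ) ^ ((F i).1 + (F i).2 - ((I i).1 + (I i).2) - 1) - 1) *
        detFun I (Function.update F i (F i - (1, 1))) := by
  conv_lhs => rw [← Function.update_eq_self i F]
  rw [detFun_update, detFun_update, detFun_update, detFun_update,
    ← Matrix.det_updateRow_smul, ← Matrix.det_updateRow_add, ← Matrix.det_updateRow_add]
  congr 2
  funext j
  have hd := hdiag i j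
  have h := qBinom_three_term ((F i).1 + (F i).2 - ((I i).1 + (I i).2) - 1) ((F i).1 - (I j).1)
    (by omega)
  simp only [detRow, Pi.add_apply, Pi.smul_apply, smul_eq_mul, Prod.fst_sub, Prod.snd_sub]
  rw [show (F i).1 - (I j).1 + (F i).2 - (I j).2 =
      (F i).1 + (F i).2 - ((I i).1 + (I i).2) - 1 + 1 by omega, h,
    show (F i).1 - 1 - (I j).1 + ((F i).2 - 0) - (I j).2 =
      (F i).1 + (F i).2 - ((I i).1 + (I i).2) - 1 by omega,
    show (F i).1 - 0 - (I j).1 + ((F i).2 - 1) - (I j).2 =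
      (F i).1 + (F i).2 - ((I i).1 + (I i).2) - 1 by omega,
    show (F i).1 - 1 - (I j).1 + ((F i).2 - 1) - (I j).2 =
      (F i).1 + (F i).2 - ((I i).1 + (I i).2) - 1 - 1 by omega,
    show (F i).1 - 1 - (I j).1 = (F i).1 - (I j).1 - 1 by omega, sub_zero]
  ring

theorem detFun_of_end_below {I F : Fin k → ℤ × ℤ} {i j : Fin k}
    (hdiag : ∀ i j : Fin k, (I i).1 + (I i).2 = (I j).1 + (I j).2) (hij : (j : ℕ) = i + 1)
    (hpos : (I i).1 + (I i).2 < (F i).1 + (F i).2) (h : F j = F i - (0, 1)) :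
    detFun I F = detFun I (Function.update F i (F i - (1, 0))) := by
  have hX : (RatFunc.X : RatFunc ℚ) ≠ 0 := RatFunc.X_ne_zero
  have hne : i ≠ j := fun e => by rw [e] at hij; omega
  conv_lhs => rw [← Function.update_eq_self i F]
  rw [detFun_update, detFun_update]
  set M : Matrix (Fin k) (Fin k) (RatFunc ℚ) :=
    (Matrix.of fun i => detRow I i (F i)).updateRow i (detRow I i (F i - (1, 0))) with hM
  -- The `N` term of row `i` in column `l` carries `q^((i+1)(x_i-x_l) + u_i-x_l)`, and row `j = i+1`
  -- (one-based index `i+2`) carries `q^((i+2)(x_j-x_l))`; the quotient is free of `l`.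
  rw [← Matrix.det_updateRow_add_smul_self M hne
    (RatFunc.X ^ (((i : ℕ) + 1 : ℤ) * (I i).1 + (F i).1 - ((i : ℕ) + 2 : ℤ) * (I j).1))]
  have hMi : M i = detRow I i (F i - (1, 0)) := Matrix.updateRow_self
  have hMj : M j = detRow I j (F j) := by rw [hM, Matrix.updateRow_ne hne.symm]; rfl
  rw [hMi, hMj, hM, Matrix.updateRow_idem]
  congr 2
  funext l
  have hd := hdiag i l
  have hp := qBinom_pascal ((F i).1 + (F i).2 - ((I i).1 + (I i).2) - 1) ((F i).1 - (I l).1)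
    (by omega)
  simp only [detRow, Pi.add_apply, Pi.smul_apply, smul_eq_mul, Prod.fst_sub, Prod.snd_sub, h, hij]
  rw [show (F i).1 - (I l).1 + (F i).2 - (I l).2 =
      (F i).1 + (F i).2 - ((I i).1 + (I i).2) - 1 + 1 by omega, hp,
    show (F i).1 - 1 - (I l).1 + ((F i).2 - 0) - (I l).2 =
      (F i).1 + (F i).2 - ((I i).1 + (I i).2) - 1 by omega,
    show (F i).1 - 0 - (I l).1 + ((F i).2 - 1) - (I l).2 =
      (F i).1 + (F i).2 - ((I i).1 + (I i).2) - 1 by omega,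
    show (F i).1 - 1 - (I l).1 = (F i).1 - (I l).1 - 1 by omega, sub_zero, mul_add,
    ← mul_assoc, ← mul_assoc, ← zpow_add₀ hX, ← zpow_add₀ hX]
  congr 3
  push_cast
  ring

/-! ### Base case: no path of positive length -/

theorem tuples_self {I : Fin k → ℤ × ℤ} (hI : Function.Injective I) :
    tuples I I = {fun _ => []} := by
  ext L
  rw [Set.mem_singleton_iff]
  constructor
  · intro h
    funext i
    have := length_of_mem_tuples h i
    rw [sub_self] at this
    exact List.length_eq_zero_iff.1 (by exact_mod_cast this)
  · rintro rfl
    refine ⟨fun i => by simp, fun i j hij => ?_⟩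
    rw [Set.disjoint_left]
    rintro p hi hj
    obtain ⟨l, hl, rfl⟩ := hi
    obtain ⟨l', hl', h⟩ := hj
    rw [List.prefix_nil] at hl hl'
    subst hl hl'
    simp only [disp_nil, add_zero] at h
    exact hij (hI h).symm

theorem genFun_self {I : Fin k → ℤ × ℤ} (hI : Function.Injective I) : genFun I I = 1 := by
  rw [genFun, tuples_self hI, finsum_mem_singleton]
  simp [weight, majSteps]

theorem detRow_apply_of_length_zero {I : Fin k → ℤ × ℤ} (i j : Fin k) {p : ℤ × ℤ}
    (h : p.1 + p.2 = (I j).1 + (I j).2) :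
    detRow I i p j = if p.1 = (I j).1 then
      RatFunc.X ^ (((i : ℕ) + 1 : ℤ) * ((I i).1 - (I j).1)) else 0 := by
  rw [detRow, show p.1 - (I j).1 + p.2 - (I j).2 = 0 by omega]
  split_ifs with h1
  · rw [h1, sub_self, qBinom_zero_zero, mul_one]
  · rw [qBinom_eq_zero (by omega), mul_zero]

theorem detFun_self {I : Fin k → ℤ × ℤ} (hI : StrictMono fun i => (I i).1)
    (hdiag : ∀ i j : Fin k, (I i).1 + (I i).2 = (I j).1 + (I j).2) : detFun I I = 1 := by
  rw [detFun, ← Matrix.det_one (n := Fin k)]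
  congr 1
  ext i j
  rw [Matrix.of_apply, detRow_apply_of_length_zero i j (hdiag i j), Matrix.one_apply]
  by_cases h : i = j
  · simp [h]
  · rw [if_neg fun e => h (hI.injective e), if_neg h]

theorem genFun_eq_detFun_of_length_nonpos {I F : Fin k → ℤ × ℤ} (hI : StrictMono fun i => (I i).1)
    (hdiag : ∀ i j : Fin k, (I i).1 + (I i).2 = (I j).1 + (I j).2)
    (hF : StrictAnti fun i => (F i).2)
    (h0 : ∀ i, (F i).1 + (F i).2 ≤ (I i).1 + (I i).2) : genFun I F = detFun I F := by
  by_cases hneg : ∃ i, (F i).1 + (F i).2 < (I i).1 + (I i).2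
  · obtain ⟨i, hi⟩ := hneg
    have h1 : tuples I F = ∅ := by
      rw [Set.eq_empty_iff_forall_notMem]
      intro L hL
      have := length_of_mem_tuples hL i
      omega
    rw [genFun, h1, finsum_mem_empty, detFun]
    refine (Matrix.det_eq_zero_of_row_eq_zero i fun j => ?_).symm
    have hd := hdiag i j
    rw [Matrix.of_apply, detRow, qBinom_eq_zero (by omega), mul_zero]
  · push Not at hneg
    have heq : ∀ i, (F i).1 + (F i).2 = (I i).1 + (I i).2 := fun i => le_antisymm (h0 i) (hneg i)
    by_cases hFI : F = I
    · subst hFI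
      rw [genFun_self fun i j h => hI.injective (congrArg Prod.fst h), detFun_self hI hdiag]
    · have h1 : tuples I F = ∅ := by
        rw [Set.eq_empty_iff_forall_notMem]
        intro L hL
        refine hFI (funext fun i => ?_)
        have h2 := length_of_mem_tuples hL i
        rw [heq, sub_self] at h2
        have h3 : L i = [] := List.length_eq_zero_iff.1 (by exact_mod_cast h2)
        rw [← hL.1 i, h3, disp_nil, add_zero]
      rw [genFun, h1, finsum_mem_empty]
      by_contra hdet
      rw [detFun, Matrix.det_apply] at hdet
      obtain ⟨σ, -, hσ⟩ := Finset.exists_ne_zero_of_sum_ne_zero (Ne.symm hdet)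
      -- A nonzero term makes the abscissas of `F` a permutation of those of `I`; both sequences
      -- increase strictly, so they coincide.
      have hu : ∀ i, (F (σ i)).1 = (I i).1 := by
        intro i
        by_contra hi
        refine hσ ?_
        rw [Finset.prod_eq_zero (Finset.mem_univ i), smul_zero]
        rw [Matrix.of_apply, detRow_apply_of_length_zero _ _ ((heq _).trans (hdiag _ _)), if_neg hi]
      have hFmono : StrictMono fun i => (F i).1 := by
        intro i j hij
        have h2 : (F j).2 < (F i).2 := hF hij
        have h3 := heq i
        have h4 := heq j
        have h5 := hdiag i j
        show (F i).1 < (F j).1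
        omega
      have hrange : Set.range (fun i => (F i).1) = Set.range fun i => (I i).1 := by
        rw [← σ.surjective.range_comp fun i => (F i).1]
        exact congrArg Set.range (funext hu)
      have hfst := (StrictMono.range_inj hFmono hI).1 hrange
      refine hFI (funext fun i => ?_)
      have h2 := congrFun hfst i
      have h3 := heq i
      exact Prod.ext h2 (by omega)

/-! ### Induction on the total length; the weak order is what survives removing an `E` step -/

/-- End points ordered weakly from west to east and strictly from north to south. -/
def IsChain (F : Fin k → ℤ × ℤ) : Prop := ∀ i j, i < j → (F i).1 ≤ (F j).1 ∧ (F j).2 < (F i).2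

theorem IsChain.update {F : Fin k → ℤ × ℤ} (hF : IsChain F) {i : Fin k} {p : ℤ × ℤ}
    (hp : p ≤ F i) (hlt : ∀ j < i, (F j).1 ≤ p.1) (hgt : ∀ j, i < j → (F j).2 < p.2) :
    IsChain (Function.update F i p) := by
  intro a b hab
  rw [Prod.le_def] at hp
  by_cases ha : a = i
  · subst ha
    rw [Function.update_self, Function.update_of_ne hab.ne']
    exact ⟨hp.1.trans (hF a b hab).1, hgt b hab⟩
  · rw [Function.update_of_ne ha]
    by_cases hb : b = i
    · subst hb
      rw [Function.update_self]
      exact ⟨hlt a hab, hp.2.trans_lt (hF a b hab).2⟩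
    · rw [Function.update_of_ne hb]
      exact hF a b hab

theorem exists_last_longest {ι : Type*} [Fintype ι] [Nonempty ι] [LinearOrder ι] (f : ι → ℤ) :
    ∃ i, (∀ j, f j ≤ f i) ∧ ∀ j, i < j → f j < f i := by
  obtain ⟨i, -, hi⟩ := Finset.exists_max_image Finset.univ (fun i => toLex (f i, i))
    Finset.univ_nonempty
  have h : ∀ j, f j < f i ∨ f j = f i ∧ j ≤ i := fun j =>
    Prod.Lex.toLex_le_toLex.1 (hi j (Finset.mem_univ j))
  refine ⟨i, fun j => ?_, fun j hj => ?_⟩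
  · rcases h j with h | h
    exacts [h.le, h.1.le]
  · exact (h j).resolve_right fun h => absurd h.2 (not_le.2 hj)

theorem genFun_eq_detFun {I : Fin k → ℤ × ℤ} (hI : StrictMono fun i => (I i).1)
    (hdiag : ∀ i j : Fin k, (I i).1 + (I i).2 = (I j).1 + (I j).2)
    (F : Fin k → ℤ × ℤ) (hF : IsChain F) : genFun I F = detFun I F := by
  induction hn : ∑ i, ((F i).1 + (F i).2 - ((I i).1 + (I i).2)).toNat using Nat.strong_induction_on
    generalizing F with
  | _ n ih =>
  subst hn
  by_cases h0 : ∀ i, (F i).1 + (F i).2 ≤ (I i).1 + (I i).2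
  · exact genFun_eq_detFun_of_length_nonpos hI hdiag (fun i j hij => (hF i j hij).2) h0
  push Not at h0
  obtain ⟨i₀, hi₀⟩ := h0
  have : Nonempty (Fin k) := ⟨i₀⟩
  obtain ⟨i, hmax, hlast⟩ := exists_last_longest fun i => (F i).1 + (F i).2
  have hpos : (I i).1 + (I i).2 < (F i).1 + (F i).2 := by
    have := hdiag i i₀
    have := hmax i₀
    omega
  -- `F j` is strictly higher but its coordinate sum is no larger.
  have hlt : ∀ j < i, (F j).1 < (F i).1 := by
    intro j hj
    have h1 := (hF j i hj).2
    have h2 := hmax j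
    omega
  have hgt : ∀ j, i < j → (F j).2 < (F i).2 := fun j hj => (hF i j hj).2
  have step : ∀ p : ℤ × ℤ, p ≤ F i → p.1 + p.2 < (F i).1 + (F i).2 → (F i).1 - 1 ≤ p.1 →
      (∀ j, i < j → (F j).2 < p.2) →
      genFun I (Function.update F i p) = detFun I (Function.update F i p) := by
    intro p hp hp1 hp2 hp3
    refine ih _ ?_ _ (hF.update hp (fun j hj => ?_) hp3) rfl
    · refine Finset.sum_lt_sum (fun j _ => ?_) ⟨i, Finset.mem_univ i, ?_⟩
      · by_cases hj : j = i
        · subst hj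
          rw [Function.update_self]
          omega
        · rw [Function.update_of_ne hj]
      · rw [Function.update_self]
        omega
    · have := hlt j hj
      omega
  have hE := step (F i - (1, 0)) (by simp [Prod.le_def])
    (by simp only [Prod.fst_sub, Prod.snd_sub]; omega) (by simp) (by simpa using hgt)
  by_cases hb : ∃ j, i < j ∧ (F j).2 = (F i).2 - 1
  · obtain ⟨j, hij, hj⟩ := hb
    have h1 := (hF i j hij).1
    have h2 := hlast j hij
    -- As `i` is the last maximizer, the sum at `j` is strictly smaller, which forces `(F j).1 ≤ (F
    -- i).1`; the chain gives the reverse.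
    have hFj : F j = F i - (0, 1) := Prod.ext (by simp; omega) (by simpa using hj)
    -- Heights decrease strictly, so no index fits between two consecutive heights.
    have hsucc : (j : ℕ) = i + 1 := by
      by_contra hne
      have hlt' : (i : ℕ) < j := hij
      let m : Fin k := ⟨i + 1, by omega⟩
      have h3 := hgt m (Fin.lt_def.2 (Nat.lt_succ_self _))
      have h4 := (hF m j (Fin.lt_def.2 (show (i : ℕ) + 1 < j by omega))).2
      omega
    rw [genFun_of_end_below hij.ne hpos hlt hgt hFj, detFun_of_end_below hdiag hsucc hpos hFj, hE]
  · have hgt' : ∀ j, i < j → (F j).2 < (F i).2 - 1 := by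
      intro j hj
      have h1 := hgt j hj
      have h2 : (F j).2 ≠ (F i).2 - 1 := fun h => hb ⟨j, hj, h⟩
      omega
    rw [genFun_three_term hpos hlt hgt', detFun_three_term hdiag hpos, hE,
      step (F i - (0, 1)) (by simp [Prod.le_def]) (by simp only [Prod.fst_sub, Prod.snd_sub]; omega) (by simp) (by simpa using hgt'),
      step (F i - (1, 1)) (by simp [Prod.le_def]) (by simp only [Prod.fst_sub, Prod.snd_sub]; omega) (by simp) (by simpa using hgt')]

end LatticePath

open Classical in
theorem theorem5 (k : ℕ) (I F : Fin k → ℤ × ℤ)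
    (hI : ∀ i j : Fin k, i < j → StrictlyNW (I i) (I j))
    (hF : ∀ i j : Fin k, i < j → StrictlyNW (F i) (F j))
    (hdiag : ∀ i j : Fin k, (I i).1 + (I i).2 = (I j).1 + (I j).2) :
    (∑ P : ((i : Fin k) → NEPath (I i) (F i)) with NonIntersecting P,
        (RatFunc.X : RatFunc ℚ) ^ totalMaj P) =
      Matrix.det (Matrix.of fun i j : Fin k =>
        (RatFunc.X : RatFunc ℚ) ^ (((i : ℕ) + 1 : ℤ) * ((I i).1 - (I j).1)) *
          qBinom ((F i).1 - (I j).1 + (F i).2 - (I j).2) ((F i).1 - (I j).1)) := by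
  rw [LatticePath.sum_eq_genFun]
  exact LatticePath.genFun_eq_detFun (fun i j hij => (hI i j hij).1) hdiag F
    fun i j hij => ⟨(hF i j hij).1.le, (hF i j hij).2⟩
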